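/- **Adapted Orthogonal Subspace Game.** The parameters are integers $1\le\tilde d\le d$, $M,k,m\ge 0$, $J\ge 1$ and reals $\beta,\gamma$. (1) The oracle samples a uniform $\tilde d$-dimensional linear subspace $E\subset\mathbb{R}^d$ (normalized Haar measure on the Grassmannian) and, given $E$, i.i.d. vectors $v_r^{(j)}$, $r\in[m]$, $j\in[J]$, uniform on the unit sphere of $E$. (2) The player observes $E$ and all the vectors $v_r^{(j)}$; based on these it stores an $M$-bit message $\mathsf{Message}\in\{0,1\}^M$ and chooses an index $\hat\jmath\in[J]$. (3) The oracle sends $v_1^{(\hat\jmath)},\dots,v_m^{(\hat\jmath)}$ to the player. (4) Based on $\mathsf{Message}$ and $v_1^{(\hat\jmath)},\dots,v_m^{(\hat\jmath)}$ only, the player returns unit vectors $y_1,\dots,y_k\in\mathbb{R}^d$. The player may be randomized, and may use the same internal randomness (independent of the oracle's samples) in steps (2) and (4). The player wins if for all $i\in[k]$ $$\|\mathrm{Proj}_E(y_i)\|\le\beta\qquad\text{and}\qquad \|\mathrm{Proj}_{\mathrm{Span}(y_1,\dots,y_{i-1})^\perp}(y_i)\|\ge\gamma .$$ **Theorem.**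 Let $d\ge 8$, $1\le\tilde d\le d$, $J\geq 1$, $C\ge 1$ and $0<\beta,\gamma\le 1$ be such that $\gamma/\beta\ge 3e\sqrt{kd/\tilde d}$. Suppose that $$\frac{\tilde d}{4}\ \ge\ k\ \ge\ 50\,C\,\frac{M+2\log_2 J+3}{\tilde d}\,\ln\frac{\sqrt d}{\gamma}.$$ If some strategy of the player wins the Adapted Orthogonal Subspace Game with probability at least $1/C$, then $m>\tilde d/2$. -/

import Mathlib

open MeasureTheory

noncomputable section

namespace OrthogonalSubspaceGame

/-- The Euclidean space `ℝ^d`. -/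
abbrev Vec (d : ℕ) : Type := EuclideanSpace ℝ (Fin d)

/-! ### The Grassmannian and its normalized Haar measure -/

/-- The Grassmannian of `n`-dimensional linear subspaces of `ℝ^d`. -/
def Gr (d n : ℕ) : Type := {E : Submodule ℝ (Vec d) // Module.finrank ℝ E = n}

/-- The topology of the Grassmannian: a subspace is identified with the orthogonal projection
onto it, and projections are compared in operator norm. -/
instance Gr.instTopologicalSpace (d n : ℕ) : TopologicalSpace (Gr d n) :=
  TopologicalSpace.induced (fun E => E.1.starProjection) inferInstance

instance Gr.instMeasurableSpace (d n : ℕ) : MeasurableSpace (Gr d n) := borel (Gr d n)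

instance Gr.instBorelSpace (d n : ℕ) : BorelSpace (Gr d n) := ⟨rfl⟩

/-- The orthogonal group `O(d)`, as the group of unitary operators of the real Hilbert
space `ℝ^d`. -/
abbrev OrthGroup (d : ℕ) : Type := unitary (Vec d →L[ℝ] Vec d)

instance instContinuousStarOperator (d : ℕ) : ContinuousStar (Vec d →L[ℝ] Vec d) :=
  ⟨(ContinuousLinearMap.adjoint (𝕜 := ℝ) (E := Vec d) (F := Vec d)).continuous⟩

instance OrthGroup.instCompactSpace (d : ℕ) : CompactSpace (OrthGroup d) := by
  have hb : Bornology.IsBounded (unitary (Vec d →L[ℝ] Vec d) : Set (Vec d →L[ℝ] Vec d)) := by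
    refine (Metric.isBounded_iff_subset_closedBall 0).2 ⟨1, fun u hu => ?_⟩
    rw [mem_closedBall_zero_iff]
    refine ContinuousLinearMap.opNorm_le_bound _ zero_le_one fun x => ?_
    have h := (Unitary.linearIsometryEquiv (𝕜 := ℝ) ⟨u, hu⟩).norm_map x
    rw [one_mul]
    exact h.le
  exact isCompact_iff_compactSpace.1
    (Metric.isCompact_of_isClosed_isBounded isClosed_unitary hb)

/-- The Haar probability measure on `O(d)`. -/
def haarOrth (d : ℕ) : Measure (OrthGroup d) := Measure.haarMeasure ⊤

instance haarOrth.instIsProbabilityMeasure (d : ℕ) : IsProbabilityMeasure (haarOrth d) :=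
  ⟨Measure.haarMeasure_self (K₀ := (⊤ : TopologicalSpace.PositiveCompacts (OrthGroup d)))⟩

/-- The image `U(E)` of a subspace `E` under an orthogonal transformation `U`. -/
def rotate {d n : ℕ} (U : OrthGroup d) (E : Gr d n) : Gr d n :=
  ⟨E.1.map (Unitary.linearIsometryEquiv (𝕜 := ℝ) U).toLinearEquiv.toLinearMap, by
    rw [LinearEquiv.finrank_map_eq]; exact E.2⟩

/-- The subspace of `ℝ^d` spanned by the first `n` vectors of the standard basis. -/
def coordSubspace (d n : ℕ) (h : n ≤ d) : Gr d n :=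
  ⟨Submodule.span ℝ (Set.range fun i : Fin n =>
      (EuclideanSpace.basisFun (Fin d) ℝ) (Fin.castLE h i)), by
    rw [finrank_span_eq_card]
    · simp
    · exact (EuclideanSpace.basisFun (Fin d) ℝ).orthonormal.linearIndependent.comp _
        (Fin.castLE_injective h)⟩

/-- The normalized Haar measure of the Grassmannian, i.e. the law of a uniform `n`-dimensional
subspace of `ℝ^d`: the image of the Haar probability measure of `O(d)` under the transitive
action on `n`-dimensional subspaces. -/
def uniformGr (d n : ℕ) (h : n ≤ d) : Measure (Gr d n) :=
  (haarOrth d).map fun U => rotate U (coordSubspace d n h)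

lemma continuous_rotate {d n : ℕ} (E : Gr d n) :
    Continuous fun U : OrthGroup d => rotate U E := by
  refine continuous_induced_rng.2 ?_
  have h : ∀ U : OrthGroup d, (rotate U E).1.starProjection
      = (U : Vec d →L[ℝ] Vec d) * E.1.starProjection * star (U : Vec d →L[ℝ] Vec d) := by
    intro U
    ext1 x
    exact Submodule.starProjection_map_apply (Unitary.linearIsometryEquiv (𝕜 := ℝ) U) E.1 x
  simp only [Function.comp_def, h]
  fun_prop

instance uniformGr.instIsProbabilityMeasure (d n : ℕ) (h : n ≤ d) :
    IsProbabilityMeasure (uniformGr d n h) :=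
  Measure.isProbabilityMeasure_map (continuous_rotate _).measurable.aemeasurable

/-! ### The uniform distribution on the unit sphere of a subspace -/

/-- The uniform probability distribution on the set of unit vectors of the subspace `E`, seen as a
measure on `ℝ^d`: the normalized surface measure of the unit sphere of `E`. -/
def uniformSphere {d : ℕ} (E : Submodule ℝ (Vec d)) : Measure (Vec d) :=
  (((volume : Measure E).toSphere Set.univ)⁻¹ • (volume : Measure E).toSphere).map
    fun x : Metric.sphere (0 : E) 1 => ((x : E) : Vec d)

lemma isProbabilityMeasure_uniformSphere {d n : ℕ} (hn : 1 ≤ n) (E : Gr d n) :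
    IsProbabilityMeasure (uniformSphere E.1) := by
  have : Nontrivial E.1 := Module.nontrivial_of_finrank_pos (R := ℝ) (by rw [E.2]; exact hn)
  have : IsProbabilityMeasure
      (((volume : Measure E.1).toSphere Set.univ)⁻¹ • (volume : Measure E.1).toSphere) := by
    refine ⟨?_⟩
    rw [Measure.smul_apply, smul_eq_mul]
    refine ENNReal.inv_mul_cancel ?_ (measure_ne_top _ _)
    rw [Measure.toSphere_apply_univ]
    refine mul_ne_zero ?_ (Metric.measure_ball_pos _ _ one_pos).ne'
    rw [E.2]
    exact_mod_cast (by lia : n ≠ 0)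
  exact Measure.isProbabilityMeasure_map
    (measurable_subtype_coe.comp measurable_subtype_coe).aemeasurable

/-! ### The Adapted Orthogonal Subspace Game -/

/-- The samples drawn by the oracle: `v j r` is the `r`-th vector of the `j`-th batch. -/
abbrev Samples (d m J : ℕ) : Type := Fin J → Fin m → Vec d

/-- A (randomized) strategy of the player. The player first observes the subspace and all the
samples, and stores an `M`-bit message and the index of a batch. Afterwards it outputs `k` unit
vectors based on the message and on the chosen batch only. Both steps may use the same internal
randomness `ω : Ω`, which is not counted in the message. -/
structure Strategy (Ω : Type*) [MeasurableSpace Ω] (d n M k m J : ℕ) where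
  message : Ω × Gr d n × Samples d m J → (Fin M → Bool)
  index : Ω × Gr d n × Samples d m J → Fin J
  output : Ω × (Fin M → Bool) × (Fin m → Vec d) → (Fin k → Metric.sphere (0 : Vec d) 1)
  measurable_message : Measurable message
  measurable_index : Measurable index
  measurable_output : Measurable output

/-- The winning condition: every `y i` is almost orthogonal to `E` and robustly independent
of `y j`, `j < i`. -/
def Wins {d k : ℕ} (β γ : ℝ) (E : Submodule ℝ (Vec d)) (y : Fin k → Vec d) : Prop :=
  ∀ i : Fin k, ‖E.starProjection (y i)‖ ≤ β ∧
    γ ≤ ‖(Submodule.span ℝ (y '' {j | j < i}))ᗮ.starProjection (y i)‖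

/-- The vectors returned by the player when its randomness is `ω`, the sampled subspace is `E` and
the samples are `v`. -/
def Strategy.play {Ω : Type*} [MeasurableSpace Ω] {d n M k m J : ℕ} (S : Strategy Ω d n M k m J)
    (ω : Ω) (E : Gr d n) (v : Samples d m J) : Fin k → Vec d :=
  fun i => S.output (ω, S.message (ω, E, v), v (S.index (ω, E, v))) i

/-- The probability that the player wins: its randomness has law `ρ`, independently `E` is a
uniform `n`-dimensional subspace of `ℝ^d`, and given `E` the samples are i.i.d. uniform unit vectors
of `E`. -/
def Strategy.winProb {Ω : Type*} [MeasurableSpace Ω] {d n M k m J : ℕ}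
    (S : Strategy Ω d n M k m J) (ρ : Measure Ω) (h : n ≤ d) (β γ : ℝ) : ENNReal :=
  ∫⁻ ω, ∫⁻ E : Gr d n,
      Measure.pi (fun _ : Fin J => Measure.pi fun _ : Fin m => uniformSphere E.1)
        {v | Wins β γ E.1 (S.play ω E v)} ∂(uniformGr d n h) ∂ρ

end OrthogonalSubspaceGame

end

/-!
If the player's vectors `y` are fixed and the subspace `T • F` is uniform, then composing `T` with
rotations that fix the span `K` of `y₁, …, yᵢ₋₁` preserves its law and the first `i - 1` winning
conditions, but turns the component of `yᵢ` orthogonal to `K`, of norm at least `γ`, into any other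
direction of `Kᗮ`. Averaging over the direction bounds the conditional probability of the `i`-th
condition by the volume of a slab `‖F.starProjection x‖ ≤ β / γ` of the unit ball, which is
estimated by stretching the slab along `F`. Hence the player wins with probability at most the
`k`-th power of the slab bound.

After seeing one batch, of span `V`, the player still knows nothing about the part of `E` orthogonal
to `V`: rotations that fix `V` do not change the batch, and one of them moves any given subspace of
small enough dimension into `E`. So the bound for a fixed `y` applies to a subspace of `E` of
dimension `finrank E - finrank V`. A union bound over the `2 ^ M` messages and the `J` batches
removes the dependence of the message and the index on the samples.
-/

open scoped Pointwise

namespace OrthogonalSubspaceGame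

section Projections

variable {𝕜 V : Type*} [RCLike 𝕜] [NormedAddCommGroup V] [InnerProductSpace 𝕜 V]

lemma norm_starProjection_le_of_le {F E : Submodule 𝕜 V} [F.HasOrthogonalProjection]
    [E.HasOrthogonalProjection] (h : F ≤ E) (y : V) :
    ‖F.starProjection y‖ ≤ ‖E.starProjection y‖ := by
  rw [← Submodule.starProjection_comp_starProjection_of_le h]
  exact F.norm_starProjection_apply_le _

lemma le_norm_starProjection_span_orthogonal_iff [FiniteDimensional 𝕜 V] {ι : Type*}
    [Fintype ι] (γ : ℝ) (v : ι → V) (x : V) :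
    γ ≤ ‖(Submodule.span 𝕜 (Set.range v))ᗮ.starProjection x‖ ↔
      ∀ a : ι → 𝕜, γ ≤ ‖x - ∑ i, a i • v i‖ := by
  set K := Submodule.span 𝕜 (Set.range v) with hK
  have hdist : ‖Kᗮ.starProjection x‖ = ⨅ z : K, ‖x - z‖ := by
    rw [Submodule.starProjection_orthogonal_val, Submodule.starProjection_minimal]
  have hbdd : BddBelow (Set.range fun z : K => ‖x - z‖) :=
    ⟨0, Set.forall_mem_range.2 fun _ => norm_nonneg _⟩
  rw [hdist, le_ciInf_iff hbdd]
  simp only [Subtype.forall, hK, Submodule.mem_span_range_iff_exists_fun, forall_exists_index,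
    forall_apply_eq_imp_iff]

lemma exists_submodule_le_finrank_eq {K W : Type*} [Field K] [AddCommGroup W] [Module K W]
    [FiniteDimensional K W] (F : Submodule K W) {N : ℕ} (hN : N ≤ Module.finrank K F) :
    ∃ F' ≤ F, Module.finrank K F' = N := by
  obtain ⟨s, hs, hli⟩ := exists_finset_linearIndependent_of_le_finrank hN
  refine ⟨(Submodule.span K (s : Set F)).map F.subtype, Submodule.map_subtype_le _ _, ?_⟩
  rw [Submodule.finrank_map_subtype_eq, finrank_span_finset_eq_card hli, hs]

lemma finrank_le_finrank_add_finrank_inf_orthogonal [FiniteDimensional 𝕜 V]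
    (K F : Submodule 𝕜 V) :
    Module.finrank 𝕜 F ≤ Module.finrank 𝕜 K + Module.finrank 𝕜 (F ⊓ Kᗮ : Submodule 𝕜 V) := by
  have hinf := Submodule.finrank_sup_add_finrank_inf_eq F Kᗮ
  have hsup := Submodule.finrank_le (F ⊔ Kᗮ)
  have horth := K.finrank_add_finrank_orthogonal
  lia

end Projections

section Isometries

variable {𝕜 V : Type*} [RCLike 𝕜] [NormedAddCommGroup V] [InnerProductSpace 𝕜 V]
  [FiniteDimensional 𝕜 V]

lemma exists_linearIsometryEquiv_map_le {F G : Submodule 𝕜 V}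
    (h : Module.finrank 𝕜 F ≤ Module.finrank 𝕜 G) :
    ∃ e : V ≃ₗᵢ[𝕜] V, ∀ x ∈ F, e x ∈ G := by
  obtain ⟨G', hG', hdim⟩ := exists_submodule_le_finrank_eq G h
  let f : F ≃ₗᵢ[𝕜] G' :=
    (stdOrthonormalBasis 𝕜 F).equiv (stdOrthonormalBasis 𝕜 G') (finCongr hdim.symm)
  let L : F →ₗᵢ[𝕜] V := G'.subtypeₗᵢ.comp f.toLinearIsometry
  refine ⟨L.extend.toLinearIsometryEquiv rfl, fun x hx => hG' ?_⟩
  have hLx : L.extend x = f ⟨x, hx⟩ := L.extend_apply ⟨x, hx⟩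
  rw [LinearIsometry.coe_toLinearIsometryEquiv, hLx]
  exact (f ⟨x, hx⟩).2

lemma exists_linearIsometryEquiv_extend_orthogonal (K : Submodule 𝕜 V) (e : Kᗮ ≃ₗᵢ[𝕜] Kᗮ) :
    ∃ f : V ≃ₗᵢ[𝕜] V, ∀ x, f x = K.starProjection x + e (Kᗮ.orthogonalProjectionOnto x) := by
  refine ⟨K.orthogonalDecomposition.trans
    ((LinearIsometryEquiv.withLpProdCongr 2 (.refl 𝕜 K) e).trans K.orthogonalDecomposition.symm),
    fun x => ?_⟩
  simp only [LinearIsometryEquiv.trans_apply]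
  rw [Submodule.orthogonalDecomposition_apply, Submodule.orthogonalDecomposition_symm_apply]
  rfl

lemma exists_linearIsometryEquiv_fix_map_le {K E F : Submodule 𝕜 V} (hKE : K ≤ E)
    (hdim : Module.finrank 𝕜 K + Module.finrank 𝕜 F ≤ Module.finrank 𝕜 E) :
    ∃ f : V ≃ₗᵢ[𝕜] V, (∀ z ∈ K, f z = z) ∧ ∀ x ∈ F, f x ∈ E := by
  have hdim' : Module.finrank 𝕜 (F.map Kᗮ.orthogonalProjectionOnto.toLinearMap) ≤
      Module.finrank 𝕜 (E.comap Kᗮ.subtype) := by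
    have hE := Submodule.finrank_add_inf_finrank_orthogonal hKE
    have hF := Submodule.finrank_map_le Kᗮ.orthogonalProjectionOnto.toLinearMap F
    have hcomap : Module.finrank 𝕜 (E.comap Kᗮ.subtype) =
        Module.finrank 𝕜 (Kᗮ ⊓ E : Submodule 𝕜 V) := by
      rw [← Submodule.map_comap_subtype, Submodule.finrank_map_subtype_eq]
    lia
  obtain ⟨e, he⟩ := exists_linearIsometryEquiv_map_le hdim'
  obtain ⟨f, hf⟩ := exists_linearIsometryEquiv_extend_orthogonal K e
  refine ⟨f, fun z hz => ?_, fun x hx => ?_⟩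
  · rw [hf, Submodule.starProjection_eq_self_iff.2 hz,
      Submodule.orthogonalProjectionOnto_apply_of_mem_orthogonal (K.le_orthogonal_orthogonal hz),
      map_zero, Submodule.coe_zero, add_zero]
  · rw [hf]
    exact E.add_mem (hKE (K.starProjection_apply_mem x)) (he _ ⟨x, hx, rfl⟩)

end Isometries

section Turn

variable {V : Type*} [NormedAddCommGroup V] [InnerProductSpace ℝ V] [FiniteDimensional ℝ V]

/-- The vector `y` with its component orthogonal to `K` turned into the direction of `x`. Everything
is scaled by `‖Kᗮ.starProjection x‖`, so that no division is needed and the expression is continuous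
in `x`. -/
noncomputable def turn (K : Submodule ℝ V) (y x : V) : V :=
  ‖Kᗮ.starProjection x‖ • K.starProjection y + ‖Kᗮ.starProjection y‖ • Kᗮ.starProjection x

variable (K : Submodule ℝ V) (y : V)

lemma continuous_turn : Continuous (turn K y) := by
  unfold turn
  fun_prop

lemma exists_linearIsometryEquiv_fix_smul_eq_turn (x : V) :
    ∃ e : V ≃ₗᵢ[ℝ] V, (∀ z ∈ K, e z = z) ∧ ‖Kᗮ.starProjection x‖ • e y = turn K y x := by
  unfold turn
  set p := Kᗮ.starProjection y with hp
  set q := Kᗮ.starProjection x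
  have hpK : ‖q‖ • p ∈ Kᗮ := Kᗮ.smul_mem _ (Kᗮ.starProjection_apply_mem y)
  have hqK : ‖p‖ • q ∈ Kᗮ := Kᗮ.smul_mem _ (Kᗮ.starProjection_apply_mem x)
  have hnorm : ‖‖q‖ • p‖ = ‖‖p‖ • q‖ := by simp only [norm_smul, norm_norm, mul_comm]
  set e := (ℝ ∙ (‖q‖ • p - ‖p‖ • q))ᗮ.reflection
  have hfix : ∀ z ∈ K, e z = z := fun z hz => by
    refine Submodule.reflection_mem_subspace_eq_self ?_
    rw [Submodule.mem_orthogonal_singleton_iff_inner_left]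
    exact Submodule.inner_right_of_mem_orthogonal hz (Kᗮ.sub_mem hpK hqK)
  have hmove : e (‖q‖ • p) = ‖p‖ • q := Submodule.reflection_sub hnorm
  refine ⟨e, hfix, ?_⟩
  calc ‖q‖ • e y = ‖q‖ • e (K.starProjection y) + e (‖q‖ • p) := by
        rw [map_smul, ← smul_add, ← map_add, hp, K.starProjection_add_starProjection_orthogonal]
    _ = ‖q‖ • K.starProjection y + ‖p‖ • q := by
        rw [hfix _ (K.starProjection_apply_mem y), hmove]

lemma norm_starProjection_turn {F : Submodule ℝ V} (hF : F ≤ Kᗮ) (x : V) :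
    ‖F.starProjection (turn K y x)‖ = ‖Kᗮ.starProjection y‖ * ‖F.starProjection x‖ := by
  have hK : F.starProjection (K.starProjection y) = 0 := by
    rw [Submodule.starProjection_apply_eq_zero_iff]
    exact Submodule.orthogonal_le hF (K.le_orthogonal_orthogonal (K.starProjection_apply_mem y))
  have hperp : F.starProjection (Kᗮ.starProjection x) = F.starProjection x := by
    rw [← ContinuousLinearMap.comp_apply, Submodule.starProjection_comp_starProjection_of_le hF]
  rw [turn, map_add, map_smul, map_smul, hK, hperp, smul_zero, zero_add, norm_smul, norm_norm]

end Turn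

section Slab

lemma det_eq_pow_finrank_of_forall_sub_mem {K V : Type*} [Field K] [AddCommGroup V] [Module K V]
    [FiniteDimensional K V] {F : Submodule K V} {f : V →ₗ[K] V} {a : K}
    (hF : ∀ x ∈ F, f x = a • x) (hquot : ∀ x, f x - x ∈ F) :
    LinearMap.det f = a ^ Module.finrank K F := by
  have hle : F ≤ F.comap f := fun x hx => by
    rw [Submodule.mem_comap, hF x hx]
    exact F.smul_mem a hx
  have hrestrict : f.restrict hle = a • LinearMap.id :=
    LinearMap.ext fun x => Subtype.ext (hF x x.2)
  have hmapQ : F.mapQ F f hle = LinearMap.id :=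
    Submodule.linearMap_qext _ (LinearMap.ext fun x => (Submodule.Quotient.eq F).2 (hquot x))
  rw [LinearMap.det_eq_det_mul_det F f hle, hrestrict, hmapQ, LinearMap.det_smul,
    LinearMap.det_id, LinearMap.det_id, mul_one, mul_one]

/-- The bound `(t √(e d / N)) ^ N` for the fraction of the unit ball of a `d`-dimensional Euclidean
space in which the projection onto a given subspace of dimension at least `N` has norm at
most `t`. -/
noncomputable def slabBound (d N : ℕ) (t : ℝ) : ℝ := (t * √(Real.exp 1 * d / N)) ^ N

variable {V : Type*} [NormedAddCommGroup V] [InnerProductSpace ℝ V] [FiniteDimensional ℝ V]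
  [MeasurableSpace V] [BorelSpace V] (μ : Measure V) [μ.IsAddHaarMeasure]

lemma ofReal_pow_mul_addHaar_slab_le (F : Submodule ℝ V) {a t : ℝ} (ha : 0 < a) :
    ENNReal.ofReal (a ^ Module.finrank ℝ F) * μ {x | ‖x‖ ≤ 1 ∧ ‖F.starProjection x‖ ≤ t} ≤
      ENNReal.ofReal (√(1 + (a * t) ^ 2) ^ Module.finrank ℝ V) * μ (Metric.closedBall 0 1) := by
  set f : V →ₗ[ℝ] V := a • F.starProjection.toLinearMap + Fᗮ.starProjection.toLinearMap
  have hfx (x : V) : f x = a • F.starProjection x + Fᗮ.starProjection x := rfl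
  have hdet : LinearMap.det f = a ^ Module.finrank ℝ F := by
    refine det_eq_pow_finrank_of_forall_sub_mem (fun x hx => ?_) fun x => ?_
    · rw [hfx, Submodule.starProjection_eq_self_iff.2 hx,
        Submodule.starProjection_orthogonal_apply_eq_zero hx, add_zero]
    · rw [hfx, Submodule.starProjection_orthogonal_val]
      have h := F.starProjection_apply_mem x
      convert F.sub_mem (F.smul_mem a h) h using 1
      abel
  have hsub : f '' {x | ‖x‖ ≤ 1 ∧ ‖F.starProjection x‖ ≤ t} ⊆
      Metric.closedBall 0 (√(1 + (a * t) ^ 2)) := by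
    rintro _ ⟨x, ⟨hx, hxt⟩, rfl⟩
    rw [mem_closedBall_zero_iff]
    refine Real.le_sqrt_of_sq_le ?_
    have horth : inner ℝ (a • F.starProjection x) (Fᗮ.starProjection x) = 0 :=
      Submodule.inner_right_of_mem_orthogonal (F.smul_mem a (F.starProjection_apply_mem x))
        (Fᗮ.starProjection_apply_mem x)
    have hpyth := norm_add_sq_eq_norm_sq_add_norm_sq_of_inner_eq_zero _ _ horth
    have hF : ‖a • F.starProjection x‖ ≤ a * t := by
      rw [norm_smul, Real.norm_of_nonneg ha.le]
      gcongr
    have hperp : ‖Fᗮ.starProjection x‖ ≤ 1 := (Fᗮ.norm_starProjection_apply_le x).trans hx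
    rw [hfx, sq, hpyth, ← sq, ← sq, add_comm]
    exact add_le_add (pow_le_one₀ (norm_nonneg _) hperp) (pow_le_pow_left₀ (norm_nonneg _) hF 2)
  calc _ = μ (f '' {x | ‖x‖ ≤ 1 ∧ ‖F.starProjection x‖ ≤ t}) := by
        rw [Measure.addHaar_image_linearMap, hdet, abs_of_pos (by positivity)]
    _ ≤ μ (Metric.closedBall 0 (√(1 + (a * t) ^ 2))) := measure_mono hsub
    _ = _ := by
      rw [Measure.addHaar_closedBall' μ 0 (Real.sqrt_nonneg _)]

lemma sqrt_one_add_div_pow_le {d : ℕ} (hd : 0 < d) (N : ℕ) :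
    √(1 + N / d) ^ d ≤ √(Real.exp 1) ^ N := by
  refine (sq_le_sq₀ (by positivity) (by positivity)).1 ?_
  rw [← pow_mul, mul_comm, pow_mul, Real.sq_sqrt (by positivity), ← pow_mul, mul_comm, pow_mul,
    Real.sq_sqrt (by positivity)]
  calc (1 + N / d : ℝ) ^ d ≤ Real.exp (N / d) ^ d := by
        gcongr
        linarith [Real.add_one_le_exp (N / d : ℝ)]
    _ = Real.exp 1 ^ N := by
        rw [← Real.exp_nat_mul, ← Real.exp_nat_mul]
        congr 1
        field_simp

lemma addHaar_slab_le (F : Submodule ℝ V) {N : ℕ} (hN : N ≤ Module.finrank ℝ F) {t : ℝ}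
    (ht : 0 < t) :
    μ {x | ‖x‖ ≤ 1 ∧ ‖F.starProjection x‖ ≤ t} ≤
      ENNReal.ofReal (slabBound (Module.finrank ℝ V) N t) * μ (Metric.closedBall 0 1) := by
  obtain rfl | hN0 := N.eq_zero_or_pos
  · simpa [slabBound] using measure_mono fun x hx => mem_closedBall_zero_iff.2 hx.1
  obtain ⟨F', hF', rfl⟩ := exists_submodule_le_finrank_eq F hN
  have hd : 0 < Module.finrank ℝ V := hN0.trans_le (Submodule.finrank_le F')
  set d := Module.finrank ℝ V
  set N := Module.finrank ℝ F'
  -- Stretching `F'` by `a` gives the bound `a⁻ᴺ (1 + a²t²)^(d/2)`, nearly minimal at `a²t² = N/d`.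
  set a := √(N / d) / t
  have hat : a * t = √(N / d) := div_mul_cancel₀ _ ht.ne'
  have ha0 : 0 < a := by positivity
  have hbound : √(Real.exp 1) ^ N = a ^ N * slabBound d N t := by
    rw [slabBound, ← mul_pow, ← mul_assoc, hat, ← Real.sqrt_mul (by positivity)]
    congr 2
    field_simp
  have hpow : ENNReal.ofReal (a ^ N) ≠ 0 := by simpa using by positivity
  refine (ENNReal.mul_le_mul_iff_right hpow ENNReal.ofReal_ne_top).1 ?_
  calc ENNReal.ofReal (a ^ N) * μ {x | ‖x‖ ≤ 1 ∧ ‖F.starProjection x‖ ≤ t}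
      ≤ ENNReal.ofReal (a ^ N) * μ {x | ‖x‖ ≤ 1 ∧ ‖F'.starProjection x‖ ≤ t} := by
        gcongr _ * μ ?_
        exact fun x hx => ⟨hx.1, (norm_starProjection_le_of_le hF' x).trans hx.2⟩
    _ ≤ ENNReal.ofReal (√(1 + N / d) ^ d) * μ (Metric.closedBall 0 1) := by
        have h := ofReal_pow_mul_addHaar_slab_le μ F' (t := t) ha0
        rwa [hat, Real.sq_sqrt (by positivity)] at h
    _ ≤ ENNReal.ofReal (√(Real.exp 1) ^ N) * μ (Metric.closedBall 0 1) := by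
        gcongr
        exact sqrt_one_add_div_pow_le hd N
    _ = ENNReal.ofReal (a ^ N) *
          (ENNReal.ofReal (slabBound d N t) * μ (Metric.closedBall 0 1)) := by
        rw [hbound, ENNReal.ofReal_mul (by positivity), mul_assoc]

lemma addHaar_turn_slab_le {F K : Submodule ℝ V} {N : ℕ} {β γ : ℝ} (hβ : 0 < β) (hγ : 0 < γ)
    (hdim : Module.finrank ℝ K + N ≤ Module.finrank ℝ F) {y : V}
    (hy : γ ≤ ‖Kᗮ.starProjection y‖) :
    μ {x | ‖x‖ ≤ 1 ∧ ‖F.starProjection (turn K y x)‖ ≤ β * ‖Kᗮ.starProjection x‖} ≤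
      ENNReal.ofReal (slabBound (Module.finrank ℝ V) N (β / γ)) * μ (Metric.closedBall 0 1) := by
  have hN : N ≤ Module.finrank ℝ (F ⊓ Kᗮ : Submodule ℝ V) := by
    have h := finrank_le_finrank_add_finrank_inf_orthogonal K F
    lia
  refine (measure_mono ?_).trans (addHaar_slab_le μ (F ⊓ Kᗮ) hN (div_pos hβ hγ))
  rintro x ⟨hx1, hx⟩
  refine ⟨hx1, (le_div_iff₀' hγ).2 ?_⟩
  calc γ * ‖(F ⊓ Kᗮ).starProjection x‖
      ≤ ‖Kᗮ.starProjection y‖ * ‖(F ⊓ Kᗮ).starProjection x‖ := by gcongr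
    _ = ‖(F ⊓ Kᗮ).starProjection (turn K y x)‖ :=
        (norm_starProjection_turn K y inf_le_right x).symm
    _ ≤ β * ‖Kᗮ.starProjection x‖ := (norm_starProjection_le_of_le inf_le_left _).trans hx
    _ ≤ β := mul_le_of_le_one_right hβ.le ((Kᗮ.norm_starProjection_apply_le x).trans hx1)

end Slab

section OrthogonalGroup

variable {d : ℕ}

instance OrthGroup.instContinuousSMul : ContinuousSMul (OrthGroup d) (Vec d) := by
  have h : Continuous fun p : OrthGroup d × Vec d => (p.1 : Vec d →L[ℝ] Vec d) p.2 := by fun_prop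
  exact ⟨h⟩

lemma exists_orthGroup_smul_eq (e : Vec d ≃ₗᵢ[ℝ] Vec d) : ∃ U : OrthGroup d, ∀ x, U • x = e x :=
  ⟨(Unitary.linearIsometryEquiv (𝕜 := ℝ)).symm e, fun _ => rfl⟩

lemma norm_orthGroup_smul (U : OrthGroup d) (x : Vec d) : ‖U • x‖ = ‖x‖ :=
  (Unitary.linearIsometryEquiv (𝕜 := ℝ) U).norm_map x

lemma finrank_orthGroup_smul (U : OrthGroup d) (F : Submodule ℝ (Vec d)) :
    Module.finrank ℝ (U • F : Submodule ℝ (Vec d)) = Module.finrank ℝ F :=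
  LinearEquiv.finrank_map_eq (Unitary.linearIsometryEquiv (𝕜 := ℝ) U).toLinearEquiv F

lemma norm_starProjection_orthGroup_smul (U : OrthGroup d) (F : Submodule ℝ (Vec d)) (x : Vec d) :
    ‖(U • F).starProjection x‖ = ‖F.starProjection (U⁻¹ • x)‖ := by
  have h : (U • F).starProjection x = U • F.starProjection (U⁻¹ • x) :=
    Submodule.starProjection_map_apply (Unitary.linearIsometryEquiv (𝕜 := ℝ) U) F x
  rw [h, norm_orthGroup_smul]

instance haarOrth.instIsHaarMeasure : (haarOrth d).IsHaarMeasure := by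
  unfold haarOrth
  infer_instance

instance haarOrth.instIsMulRightInvariant : (haarOrth d).IsMulRightInvariant := by
  refine ⟨fun g => ?_⟩
  have := Measure.isProbabilityMeasure_map (μ := haarOrth d) (measurable_mul_const g).aemeasurable
  exact Measure.isHaarMeasure_eq_of_isProbabilityMeasure _ _

end OrthogonalGroup

section AntiConcentration

lemma mul_measure_univ_le_lintegral_of_forall_le {X Y : Type*} [MeasurableSpace X]
    [MeasurableSpace Y] (μ : Measure X) (ν : Measure Y) [SFinite μ] [SFinite ν] {G : Set (X × Y)}
    (hG : MeasurableSet G) {a : ENNReal} (ha : ∀ y, a ≤ μ ((·, y) ⁻¹' G)) :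
    a * ν Set.univ ≤ ∫⁻ x, ν (Prod.mk x ⁻¹' G) ∂μ :=
  calc a * ν Set.univ = ∫⁻ _, a ∂ν := (lintegral_const a).symm
    _ ≤ ∫⁻ y, μ ((·, y) ⁻¹' G) ∂ν := lintegral_mono ha
    _ = μ.prod ν G := (Measure.prod_apply_symm hG).symm
    _ = ∫⁻ x, ν (Prod.mk x ⁻¹' G) ∂μ := Measure.prod_apply hG

variable {d N : ℕ} {β γ : ℝ} {F K : Submodule ℝ (Vec d)} {A : Set (OrthGroup d)}

lemma haarOrth_inter_le_turn (hAK : ∀ S : OrthGroup d, (∀ z ∈ K, S • z = z) → ∀ T ∈ A, S * T ∈ A)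
    (y x : Vec d) :
    haarOrth d (A ∩ {T | ‖(T • F).starProjection y‖ ≤ β}) ≤ haarOrth d {T | T ∈ A ∧
      ‖(T • F).starProjection (turn K y x)‖ ≤ β * ‖Kᗮ.starProjection x‖} := by
  obtain ⟨e, heK, hey⟩ := exists_linearIsometryEquiv_fix_smul_eq_turn K y x
  obtain ⟨S, hS⟩ := exists_orthGroup_smul_eq e
  rw [← measure_preimage_mul (haarOrth d) S {T | T ∈ A ∧ _}]
  refine measure_mono ?_
  rintro T ⟨hTA, hT⟩
  refine ⟨hAK S (fun z hz => (hS z).trans (heK z hz)) T hTA, ?_⟩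
  have hturn : (S * T)⁻¹ • turn K y x = ‖Kᗮ.starProjection x‖ • T⁻¹ • y := by
    rw [← hey, ← hS, smul_comm, mul_inv_rev, mul_smul, inv_smul_smul S y]
  rw [Set.mem_ofPred_eq, norm_starProjection_orthGroup_smul] at hT
  rw [norm_starProjection_orthGroup_smul, hturn, map_smul, norm_smul, norm_norm, mul_comm]
  gcongr

lemma isClosed_setOf_norm_starProjection_turn_le (y : Vec d) :
    IsClosed {p : OrthGroup d × Vec d |
      ‖(p.1 • F).starProjection (turn K y p.2)‖ ≤ β * ‖Kᗮ.starProjection p.2‖} := by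
  simp only [norm_starProjection_orthGroup_smul]
  have hturn : Continuous fun p : OrthGroup d × Vec d => p.1⁻¹ • turn K y p.2 :=
    continuous_fst.inv.smul ((continuous_turn K y).comp continuous_snd)
  exact isClosed_le (F.starProjection.continuous.comp hturn).norm (by fun_prop)

lemma haarOrth_inter_le_mul (hβ : 0 < β) (hγ : 0 < γ)
    (hdim : Module.finrank ℝ K + N ≤ Module.finrank ℝ F) {y : Vec d}
    (hy : γ ≤ ‖Kᗮ.starProjection y‖) (hA : MeasurableSet A)
    (hAK : ∀ S : OrthGroup d, (∀ z ∈ K, S • z = z) → ∀ T ∈ A, S * T ∈ A) :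
    haarOrth d (A ∩ {T | ‖(T • F).starProjection y‖ ≤ β}) ≤
      ENNReal.ofReal (slabBound d N (β / γ)) * haarOrth d A := by
  set B : Set (Vec d) := Metric.closedBall 0 1
  set c := ENNReal.ofReal (slabBound d N (β / γ))
  set G : Set (OrthGroup d × Vec d) := {p | p.1 ∈ A ∧
    ‖(p.1 • F).starProjection (turn K y p.2)‖ ≤ β * ‖Kᗮ.starProjection p.2‖}
  have hG : MeasurableSet G :=
    (measurable_fst hA).inter (isClosed_setOf_norm_starProjection_turn_le y).measurableSet
  have hsection (T : OrthGroup d) : volume.restrict B (Prod.mk T ⁻¹' G) ≤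
      A.indicator (fun _ => c * volume B) T := by
    by_cases hT : T ∈ A
    · rw [Set.indicator_of_mem hT, Measure.restrict_apply (measurable_prodMk_left hG)]
      have hslab := addHaar_turn_slab_le volume (F := T • F) hβ hγ
        (by rwa [finrank_orthGroup_smul]) hy
      rw [finrank_euclideanSpace_fin] at hslab
      refine (measure_mono ?_).trans hslab
      exact fun x hx => ⟨mem_closedBall_zero_iff.1 hx.2, hx.1.2⟩
    · have hempty : Prod.mk T ⁻¹' G = ∅ := Set.eq_empty_of_forall_notMem fun x hx => hT hx.1
      rw [hempty, measure_empty]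
      exact zero_le
  have hB0 : volume B ≠ 0 := (Metric.measure_closedBall_pos _ _ one_pos).ne'
  refine (ENNReal.mul_le_mul_iff_left hB0 measure_closedBall_lt_top.ne).1 ?_
  calc _ ≤ ∫⁻ T, volume.restrict B (Prod.mk T ⁻¹' G) ∂haarOrth d := by
        have h := mul_measure_univ_le_lintegral_of_forall_le _ (volume.restrict B) hG
          (haarOrth_inter_le_turn hAK y)
        rwa [Measure.restrict_apply_univ] at h
    _ ≤ ∫⁻ T, A.indicator (fun _ => c * volume B) T ∂haarOrth d := lintegral_mono hsection
    _ = c * haarOrth d A * volume B := by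
        rw [lintegral_indicator_const hA]
        ring

end AntiConcentration

section Wins

variable {d k N : ℕ} {β γ : ℝ}

lemma Wins.mono {E F : Submodule ℝ (Vec d)} {y : Fin k → Vec d} (h : Wins β γ E y) (hFE : F ≤ E) :
    Wins β γ F y :=
  fun i => ⟨(norm_starProjection_le_of_le hFE _).trans (h i).1, (h i).2⟩

lemma Wins.smul_of_fixed {E : Submodule ℝ (Vec d)} {y : Fin k → Vec d} (h : Wins β γ E y)
    {S : OrthGroup d} (hS : ∀ i, S • y i = y i) : Wins β γ (S • E) y := fun i => by
  have hS' : S⁻¹ • y i = y i := by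
    conv_rhs => rw [← inv_smul_smul S (y i), hS i]
  rw [norm_starProjection_orthGroup_smul, hS']
  exact h i

lemma wins_succ_iff {E : Submodule ℝ (Vec d)} {y : Fin (k + 1) → Vec d} :
    Wins β γ E y ↔ Wins β γ E (Fin.init y) ∧ ‖E.starProjection (y (Fin.last k))‖ ≤ β ∧
      γ ≤ ‖(Submodule.span ℝ (Set.range (Fin.init y)))ᗮ.starProjection (y (Fin.last k))‖ := by
  have hlast : y '' {j | j < Fin.last k} = Set.range (Fin.init y) := by
    ext; simp [Fin.exists_fin_succ', Fin.init, Fin.castSucc_lt_last]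
  have hcast (i : Fin k) : y '' {j | j < i.castSucc} = Fin.init y '' {j | j < i} := by
    ext; simp [Fin.exists_fin_succ', Fin.init, (Fin.castSucc_lt_last i).not_gt]
  rw [Wins, Fin.forall_fin_succ']
  simp only [hlast, hcast]
  rfl

lemma isClosed_setOf_wins (E : Submodule ℝ (Vec d)) :
    IsClosed {p : OrthGroup d × (Fin k → Vec d) | Wins β γ (p.1 • E) p.2} := by
  simp only [Wins, norm_starProjection_orthGroup_smul, Set.image_eq_range,
    le_norm_starProjection_span_orthogonal_iff, Set.ofPred_forall, Set.ofPred_and]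
  refine isClosed_iInter fun i => ?_
  have hsmul : Continuous fun p : OrthGroup d × (Fin k → Vec d) => p.1⁻¹ • p.2 i :=
    continuous_fst.inv.smul ((continuous_apply i).comp continuous_snd)
  exact (isClosed_le (E.starProjection.continuous.comp hsmul).norm continuous_const).inter
    (isClosed_iInter fun a => isClosed_le continuous_const (by fun_prop))

lemma haarOrth_setOf_wins_le (hβ : 0 < β) (hγ : 0 < γ) {F : Submodule ℝ (Vec d)}
    (hdim : N + k ≤ Module.finrank ℝ F) (y : Fin k → Vec d) :
    haarOrth d {T | Wins β γ (T • F) y} ≤ ENNReal.ofReal (slabBound d N (β / γ)) ^ k := by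
  induction k with
  | zero => simpa using prob_le_one
  | succ k ih =>
    set K := Submodule.span ℝ (Set.range (Fin.init y))
    set A : Set (OrthGroup d) := {T | Wins β γ (T • F) (Fin.init y)}
    have hsub : {T : OrthGroup d | Wins β γ (T • F) y} ⊆
        A ∩ {T | ‖(T • F).starProjection (y (Fin.last k))‖ ≤ β} :=
      fun T hT => ⟨(wins_succ_iff.1 hT).1, (wins_succ_iff.1 hT).2.1⟩
    by_cases hlast : γ ≤ ‖Kᗮ.starProjection (y (Fin.last k))‖
    · have hK : Module.finrank ℝ K ≤ k :=
        (finrank_range_le_card (R := ℝ) (Fin.init y)).trans_eq (Fintype.card_fin k)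
      have hA : MeasurableSet A :=
        ((isClosed_setOf_wins F).preimage (Continuous.prodMk_left (Fin.init y))).measurableSet
      have hAK (S : OrthGroup d) (hS : ∀ z ∈ K, S • z = z) (T : OrthGroup d) (hT : T ∈ A) :
          S * T ∈ A := by
        rw [Set.mem_ofPred_eq, mul_smul S T F]
        exact Wins.smul_of_fixed hT fun i => hS _ (Submodule.subset_span (Set.mem_range_self i))
      calc _ ≤ _ := measure_mono hsub
        _ ≤ ENNReal.ofReal (slabBound d N (β / γ)) * haarOrth d A :=
          haarOrth_inter_le_mul hβ hγ (by omega) hlast hA hAK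
        _ ≤ ENNReal.ofReal (slabBound d N (β / γ)) ^ (k + 1) := by
          rw [pow_succ']
          gcongr
          exact ih (by omega) (Fin.init y)
    · have hempty : {T : OrthGroup d | Wins β γ (T • F) y} = ∅ :=
        Set.eq_empty_of_forall_notMem fun T hT => hlast (wins_succ_iff.1 hT).2.2
      rw [hempty, measure_empty]
      exact zero_le

lemma haarOrth_setOf_wins_adaptive_le (hβ : 0 < β) (hγ : 0 < γ) {V E : Submodule ℝ (Vec d)}
    (hVE : V ≤ E) (hdim : N + k + Module.finrank ℝ V ≤ Module.finrank ℝ E)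
    {y : OrthGroup d → Fin k → Vec d} (hy : Measurable y)
    (hyV : ∀ S : OrthGroup d, (∀ z ∈ V, S • z = z) → ∀ U, y (U * S) = y U) :
    haarOrth d {U | Wins β γ (U • E) (y U)} ≤ ENNReal.ofReal (slabBound d N (β / γ)) ^ k := by
  obtain ⟨F, -, hF⟩ := exists_submodule_le_finrank_eq E (N := N + k) (by omega)
  set G : Set (OrthGroup d × OrthGroup d) := {p | Wins β γ ((p.1 * p.2) • F) (y p.1)}
  have hG : MeasurableSet G :=
    (measurable_mul.prodMk (hy.comp measurable_fst)) (isClosed_setOf_wins F).measurableSet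
  have hslice (T : OrthGroup d) : haarOrth d {U | Wins β γ (U • E) (y U)} ≤
      haarOrth d ((·, T) ⁻¹' G) := by
    obtain ⟨f, hfV, hfE⟩ := exists_linearIsometryEquiv_fix_map_le hVE (F := T • F)
      (by rw [finrank_orthGroup_smul]; omega)
    obtain ⟨R, hR⟩ := exists_orthGroup_smul_eq f
    have hle : R • T • F ≤ E := by
      rintro _ ⟨x, hx, rfl⟩
      exact (congrArg (· ∈ E) (hR x)).mpr (hfE x hx)
    -- `U * R` shows the player the same data as `U`, and `(U * R) • T • F` lies in `U • E`.
    rw [← measure_preimage_mul_right (haarOrth d) R ((·, T) ⁻¹' G)]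
    refine measure_mono fun U (hU : Wins β γ (U • E) (y U)) => ?_
    change Wins β γ ((U * R * T) • F) (y (U * R))
    rw [hyV R fun z hz => (hR z).trans (hfV z hz), mul_assoc, mul_smul U (R * T) F, mul_smul R T F]
    exact hU.mono (Submodule.map_mono hle)
  have hsection (U : OrthGroup d) : haarOrth d (Prod.mk U ⁻¹' G) ≤
      ENNReal.ofReal (slabBound d N (β / γ)) ^ k :=
    calc haarOrth d (Prod.mk U ⁻¹' G) = haarOrth d {T | Wins β γ (T • F) (y U)} :=
          measure_preimage_mul (haarOrth d) U {T | Wins β γ (T • F) (y U)}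
      _ ≤ _ := haarOrth_setOf_wins_le hβ hγ hF.ge (y U)
  calc _ ≤ ∫⁻ U, haarOrth d (Prod.mk U ⁻¹' G) ∂haarOrth d := by
        simpa using mul_measure_univ_le_lintegral_of_forall_le _ (haarOrth d) hG hslice
    _ ≤ ∫⁻ _, ENNReal.ofReal (slabBound d N (β / γ)) ^ k ∂haarOrth d := lintegral_mono hsection
    _ = _ := by rw [lintegral_const, measure_univ, mul_one]

end Wins

section Sphere

lemma map_coe_toSphere_apply {V : Type*} [NormedAddCommGroup V] [NormedSpace ℝ V]
    [MeasurableSpace V] [BorelSpace V] (μ : Measure V) {A : Set V} (hA : MeasurableSet A) :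
    μ.toSphere.map (↑) A =
      Module.finrank ℝ V * μ (Set.Ioo (0 : ℝ) 1 • (Metric.sphere 0 1 ∩ A)) := by
  rw [Measure.map_apply measurable_subtype_coe hA,
    Measure.toSphere_apply' _ (measurable_subtype_coe hA), Subtype.image_preimage_coe]

lemma map_map_coe_toSphere {V W : Type*} [NormedAddCommGroup V] [InnerProductSpace ℝ V]
    [FiniteDimensional ℝ V] [MeasurableSpace V] [BorelSpace V] [NormedAddCommGroup W]
    [InnerProductSpace ℝ W] [FiniteDimensional ℝ W] [MeasurableSpace W] [BorelSpace W]
    (e : V ≃ₗᵢ[ℝ] W) :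
    ((volume : Measure V).toSphere.map (↑)).map e = (volume : Measure W).toSphere.map (↑) := by
  have hcone (A : Set W) : e ⁻¹' (Set.Ioo (0 : ℝ) 1 • (Metric.sphere 0 1 ∩ A)) =
      Set.Ioo (0 : ℝ) 1 • (Metric.sphere 0 1 ∩ e ⁻¹' A) := by
    have hsphere : e ⁻¹' Metric.sphere 0 1 = Metric.sphere 0 1 := by
      rw [e.preimage_sphere, map_zero]
    have himage (B : Set W) : e ⁻¹' B = e.symm '' B := (e.symm.image_eq_preimage_symm B).symm
    rw [← hsphere, ← Set.preimage_inter, himage, himage]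
    exact Set.image_image2_distrib_right fun a x => map_smul e.symm a x
  ext A hA
  have he := e.continuous.measurable
  rw [Measure.map_apply he hA, map_coe_toSphere_apply _ (he hA), map_coe_toSphere_apply _ hA,
    ← hcone, e.toLinearEquiv.finrank_eq,
    e.measurePreserving.measure_preimage_emb e.toHomeomorph.measurableEmbedding]

variable {d n : ℕ}

lemma uniformSphere_eq_smul_map (E : Submodule ℝ (Vec d)) :
    uniformSphere E = ((volume : Measure E).toSphere.map Subtype.val Set.univ)⁻¹ •
      ((volume : Measure E).toSphere.map Subtype.val).map Subtype.val := by
  rw [uniformSphere, Measure.map_smul,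
    Measure.map_map measurable_subtype_coe measurable_subtype_coe,
    Measure.map_apply measurable_subtype_coe .univ, Set.preimage_univ]
  rfl

lemma uniformSphere_orthGroup_smul (U : OrthGroup d) (E : Submodule ℝ (Vec d)) :
    uniformSphere (U • E) = (uniformSphere E).map (U • ·) := by
  let e : E ≃ₗᵢ[ℝ] (U • E : Submodule ℝ (Vec d)) :=
    (Unitary.linearIsometryEquiv (𝕜 := ℝ) U).submoduleMap E
  have he := e.continuous.measurable
  rw [uniformSphere_eq_smul_map, uniformSphere_eq_smul_map, ← map_map_coe_toSphere e,
    Measure.map_apply he .univ, Set.preimage_univ, Measure.map_smul,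
    Measure.map_map measurable_subtype_coe he,
    Measure.map_map (measurable_const_smul U) measurable_subtype_coe]
  rfl

lemma ae_mem_uniformSphere (E : Submodule ℝ (Vec d)) : ∀ᵐ x ∂uniformSphere E, x ∈ E := by
  refine (ae_map_iff ?_ E.closed_of_finiteDimensional.measurableSet).2 ?_
  · exact (measurable_subtype_coe.comp measurable_subtype_coe).aemeasurable
  · exact .of_forall fun x => (x : E).2

lemma pi_uniformSphere_rotate {ι : Type*} [Fintype ι] (hn : 1 ≤ n) (U : OrthGroup d)
    (E : Gr d n) :
    Measure.pi (fun _ : ι => uniformSphere (rotate U E).1) =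
      (Measure.pi fun _ : ι => uniformSphere E.1).map (U • ·) := by
  have := isProbabilityMeasure_uniformSphere hn E
  have hU := (measurable_const_smul (α := Vec d) U).aemeasurable (μ := uniformSphere E.1)
  have := Measure.isProbabilityMeasure_map hU
  change Measure.pi (fun _ : ι => uniformSphere (U • E.1)) = _
  rw [uniformSphere_orthGroup_smul]
  exact (Measure.pi_map_pi fun _ => hU).symm

end Sphere

section OneBatch

variable {d n k N : ℕ} {ι : Type*} {β γ : ℝ} {g : (ι → Vec d) → Fin k → Vec d}

lemma measurableSet_setOf_wins_comp (E : Submodule ℝ (Vec d)) (hg : Measurable g) :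
    MeasurableSet {w | Wins β γ E (g w)} := by
  have h := (measurable_const.prodMk hg : Measurable fun w => ((1 : OrthGroup d), g w))
    (isClosed_setOf_wins (β := β) (γ := γ) E).measurableSet
  simpa only [Set.preimage_ofPred_eq, one_smul (OrthGroup d) E] using h

lemma measurableSet_setOf_wins_comp_smul [Finite ι] (E : Submodule ℝ (Vec d))
    (hg : Measurable g) :
    MeasurableSet {p : OrthGroup d × (ι → Vec d) | Wins β γ (p.1 • E) (g (p.1 • p.2))} :=
  have hsmul : Continuous fun p : OrthGroup d × (ι → Vec d) => p.1 • p.2 :=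
    continuous_pi fun r => continuous_fst.smul ((continuous_apply r).comp continuous_snd)
  (measurable_fst.prodMk (hg.comp hsmul.measurable)) (isClosed_setOf_wins E).measurableSet

variable [Fintype ι]

lemma haarOrth_setOf_wins_comp_smul_le (hβ : 0 < β) (hγ : 0 < γ) {E : Submodule ℝ (Vec d)}
    (hdim : N + k + Fintype.card ι ≤ Module.finrank ℝ E) (hg : Measurable g) {w : ι → Vec d}
    (hw : ∀ r, w r ∈ E) :
    haarOrth d {U | Wins β γ (U • E) (g (U • w))} ≤
      ENNReal.ofReal (slabBound d N (β / γ)) ^ k := by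
  have hV : Module.finrank ℝ (Submodule.span ℝ (Set.range w)) ≤ Fintype.card ι :=
    finrank_range_le_card w
  refine haarOrth_setOf_wins_adaptive_le hβ hγ
    (Submodule.span_le.2 (Set.range_subset_iff.2 hw)) (by omega) ?_ fun S hS U => ?_
  · exact hg.comp (continuous_id.smul continuous_const).measurable
  · congr 1
    ext1 r
    rw [Pi.smul_apply, Pi.smul_apply, mul_smul,
      hS _ (Submodule.subset_span (Set.mem_range_self r))]

lemma pi_uniformSphere_rotate_setOf_wins (hn : 1 ≤ n) (hg : Measurable g) (U : OrthGroup d)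
    (E : Gr d n) :
    Measure.pi (fun _ : ι => uniformSphere (rotate U E).1) {w | Wins β γ (rotate U E).1 (g w)} =
      Measure.pi (fun _ : ι => uniformSphere E.1)
        (Prod.mk U ⁻¹' {p | Wins β γ (p.1 • E.1) (g (p.1 • p.2))}) := by
  rw [pi_uniformSphere_rotate hn, Measure.map_apply (measurable_const_smul U)
    (measurableSet_setOf_wins_comp _ hg)]
  rfl

lemma measurable_pi_uniformSphere_rotate_setOf_wins (hn : 1 ≤ n) (hg : Measurable g)
    (E : Gr d n) :
    Measurable fun U : OrthGroup d =>
      Measure.pi (fun _ : ι => uniformSphere (rotate U E).1)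
        {w | Wins β γ (rotate U E).1 (g w)} := by
  have := isProbabilityMeasure_uniformSphere hn E
  simp only [pi_uniformSphere_rotate_setOf_wins hn hg]
  exact measurable_measure_prodMk_left (measurableSet_setOf_wins_comp_smul E.1 hg)

lemma lintegral_pi_uniformSphere_rotate_setOf_wins_le (hβ : 0 < β) (hγ : 0 < γ) (hn : 1 ≤ n)
    (hdim : N + k + Fintype.card ι ≤ n) (hg : Measurable g) (E : Gr d n) :
    ∫⁻ U, Measure.pi (fun _ : ι => uniformSphere (rotate U E).1)
        {w | Wins β γ (rotate U E).1 (g w)} ∂haarOrth d ≤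
      ENNReal.ofReal (slabBound d N (β / γ)) ^ k := by
  have := isProbabilityMeasure_uniformSphere hn E
  set μ := Measure.pi fun _ : ι => uniformSphere E.1
  have hG := measurableSet_setOf_wins_comp_smul (β := β) (γ := γ) E.1 hg
  have hmem : ∀ᵐ w ∂μ, ∀ r, w r ∈ E.1 := ae_all_iff.2 fun r =>
    (measurePreserving_eval (fun _ : ι => uniformSphere E.1) r).quasiMeasurePreserving.ae
      (ae_mem_uniformSphere E.1)
  simp only [pi_uniformSphere_rotate_setOf_wins hn hg]
  rw [← Measure.prod_apply hG, Measure.prod_apply_symm hG]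
  calc _ ≤ ∫⁻ _, ENNReal.ofReal (slabBound d N (β / γ)) ^ k ∂μ := by
        refine lintegral_mono_ae (hmem.mono fun w hw => ?_)
        exact haarOrth_setOf_wins_comp_smul_le hβ hγ (by rwa [E.2]) hg hw
    _ = _ := by rw [lintegral_const, measure_univ, mul_one]

end OneBatch

section WinningProbability

variable {Ω : Type*} [MeasurableSpace Ω] {d n M k m J N : ℕ} {β γ : ℝ}

/-- The vectors returned by the player when its randomness is `ω`, the message is `s` and the chosen
batch is `w`; in contrast to `Strategy.play`, neither `s` nor the index of `w` depends on the
samples. -/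
def Strategy.reply (S : Strategy Ω d n M k m J) (ω : Ω) (s : Fin M → Bool) (w : Fin m → Vec d) :
    Fin k → Vec d :=
  fun i => S.output (ω, s, w) i

lemma Strategy.measurable_reply (S : Strategy Ω d n M k m J) (ω : Ω) (s : Fin M → Bool) :
    Measurable (S.reply ω s) :=
  measurable_pi_lambda _ fun i =>
    measurable_subtype_coe.comp ((measurable_pi_apply i).comp (S.measurable_output.comp
      (measurable_const.prodMk (measurable_const.prodMk measurable_id))))

lemma Strategy.pi_setOf_wins_play_le (S : Strategy Ω d n M k m J) (hn : 1 ≤ n) (ω : Ω)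
    (E : Gr d n) :
    Measure.pi (fun _ : Fin J => Measure.pi fun _ : Fin m => uniformSphere E.1)
        {v | Wins β γ E.1 (S.play ω E v)} ≤
      ∑ _j : Fin J, ∑ s : Fin M → Bool, Measure.pi (fun _ : Fin m => uniformSphere E.1)
        {w | Wins β γ E.1 (S.reply ω s w)} := by
  have := isProbabilityMeasure_uniformSphere hn E
  have hsub : {v | Wins β γ E.1 (S.play ω E v)} ⊆ ⋃ j : Fin J, ⋃ s : Fin M → Bool,
      Function.eval j ⁻¹' {w | Wins β γ E.1 (S.reply ω s w)} := by
    intro v hv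
    refine Set.mem_iUnion₂.2 ⟨S.index (ω, E, v), S.message (ω, E, v), ?_⟩
    rw [Set.mem_preimage, Function.eval, Set.mem_ofPred_eq]
    exact hv
  refine (measure_mono hsub).trans ((measure_iUnion_fintype_le _ _).trans ?_)
  refine Finset.sum_le_sum fun j _ => (measure_iUnion_fintype_le _ _).trans ?_
  refine Finset.sum_le_sum fun s _ => le_of_eq ?_
  exact (measurePreserving_eval
    (fun _ : Fin J => Measure.pi fun _ : Fin m => uniformSphere E.1) j).measure_preimage
      (measurableSet_setOf_wins_comp E.1 (S.measurable_reply ω s)).nullMeasurableSet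

lemma Strategy.lintegral_pi_setOf_wins_play_le (S : Strategy Ω d n M k m J) (hβ : 0 < β)
    (hγ : 0 < γ) (hn : 1 ≤ n) (hnd : n ≤ d) (hdim : N + k + m ≤ n) (ω : Ω) :
    ∫⁻ E : Gr d n, Measure.pi (fun _ : Fin J => Measure.pi fun _ : Fin m => uniformSphere E.1)
        {v | Wins β γ E.1 (S.play ω E v)} ∂uniformGr d n hnd ≤
      J * (2 ^ M * ENNReal.ofReal (slabBound d N (β / γ)) ^ k) := by
  set E₀ := coordSubspace d n hnd
  have hmeas (s : Fin M → Bool) := measurable_pi_uniformSphere_rotate_setOf_wins (β := β) (γ := γ)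
    hn (S.measurable_reply ω s) E₀
  refine (lintegral_map_le _ _).trans ?_
  calc _ ≤ ∫⁻ U, ∑ _j : Fin J, ∑ s : Fin M → Bool,
          Measure.pi (fun _ : Fin m => uniformSphere (rotate U E₀).1)
            {w | Wins β γ (rotate U E₀).1 (S.reply ω s w)} ∂haarOrth d :=
        lintegral_mono fun U => S.pi_setOf_wins_play_le hn ω (rotate U E₀)
    _ = ∑ _j : Fin J, ∑ s : Fin M → Bool, ∫⁻ U,
          Measure.pi (fun _ : Fin m => uniformSphere (rotate U E₀).1)
            {w | Wins β γ (rotate U E₀).1 (S.reply ω s w)} ∂haarOrth d := by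
        rw [lintegral_finsetSum _ fun _ _ => Finset.measurable_sum _ fun s _ => hmeas s]
        simp_rw [lintegral_finsetSum _ fun s _ => hmeas s]
    _ ≤ ∑ _j : Fin J, ∑ _s : Fin M → Bool, ENNReal.ofReal (slabBound d N (β / γ)) ^ k := by
        gcongr with j _ s _
        exact lintegral_pi_uniformSphere_rotate_setOf_wins_le hβ hγ hn
          (by rwa [Fintype.card_fin]) (S.measurable_reply ω s) E₀
    _ = _ := by simp

theorem Strategy.winProb_le (S : Strategy Ω d n M k m J) (ρ : Measure Ω) [IsProbabilityMeasure ρ]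
    (hβ : 0 < β) (hγ : 0 < γ) (hn : 1 ≤ n) (hnd : n ≤ d) (hdim : N + k + m ≤ n) :
    S.winProb ρ hnd β γ ≤ J * (2 ^ M * ENNReal.ofReal (slabBound d N (β / γ)) ^ k) := by
  refine (lintegral_mono (S.lintegral_pi_setOf_wins_play_le hβ hγ hn hnd hdim)).trans_eq ?_
  rw [lintegral_const, measure_univ, mul_one]

end WinningProbability

section Numerics

lemma slabBound_le_one_half_pow {d N n k : ℕ} {β γ : ℝ} (hβ : 0 < β) (hγ : 0 < γ) (hk : 1 ≤ k)
    (hn : 1 ≤ n) (hN : n ≤ 4 * N) (hγβ : 3 * Real.exp 1 * √(k * d / n) ≤ γ / β) :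
    slabBound d N (β / γ) ≤ (1 / 2) ^ N := by
  have hk' : (1 : ℝ) ≤ k := mod_cast hk
  have hn' : (0 : ℝ) < n := mod_cast hn
  have hN' : (n : ℝ) ≤ 4 * N := mod_cast hN
  have : (0 : ℝ) < N := by linarith
  have hsqrt : 2 * √(Real.exp 1 * d / N) ≤ γ / β :=
    calc 2 * √(Real.exp 1 * d / N) = √(4 * (Real.exp 1 * d / N)) := by
          rw [Real.sqrt_mul (by norm_num), show (4 : ℝ) = 2 ^ 2 by norm_num,
            Real.sqrt_sq (by norm_num)]
      _ ≤ √((3 * Real.exp 1) ^ 2 * (k * d / n)) := by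
          refine Real.sqrt_le_sqrt ?_
          have he := Real.exp_one_gt_d9
          calc 4 * (Real.exp 1 * d / N) ≤ 4 * (Real.exp 1 * d / (n / 4)) := by
                gcongr
                linarith
            _ = 16 * Real.exp 1 * (1 * d / n) := by
                ring
            _ ≤ (3 * Real.exp 1) ^ 2 * (k * d / n) := by
                gcongr
                nlinarith
      _ = 3 * Real.exp 1 * √(k * d / n) := by
          rw [Real.sqrt_mul (by positivity), Real.sqrt_sq (by positivity)]
      _ ≤ γ / β := hγβ
  refine pow_le_pow_left₀ (by positivity) ?_ N
  rw [← inv_div γ β, inv_mul_le_iff₀ (by positivity)]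
  linarith

lemma one_half_le_log_sqrt_div {x γ : ℝ} (hx : Real.exp 1 ≤ x) (hγ : 0 < γ) (hγ1 : γ ≤ 1) :
    1 / 2 ≤ Real.log (√x / γ) := by
  have hx0 : 0 < x := (Real.exp_pos 1).trans_le hx
  calc 1 / 2 ≤ Real.log x / 2 := by
        gcongr
        exact (Real.le_log_iff_exp_le hx0).2 hx
    _ = Real.log √x := (Real.log_sqrt hx0.le).symm
    _ ≤ Real.log (√x / γ) := by
        gcongr
        exact le_div_self (Real.sqrt_nonneg x) hγ hγ1

lemma half_mul_le_mul_of_mul_div_mul_le {a x n k L : ℝ} (ha : 0 ≤ a) (hx : 0 ≤ x) (hn : 0 < n)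
    (hL : 1 / 2 ≤ L) (h : a * (x / n) * L ≤ k) : a / 2 * x ≤ k * n := by
  rw [← div_le_iff₀ hn]
  calc a / 2 * x / n = a * (x / n) * (1 / 2) := by ring
    _ ≤ a * (x / n) * L := by gcongr
    _ ≤ k := h

lemma logb_two_le_two_mul {x : ℝ} (hx : 0 < x) : Real.logb 2 x ≤ 2 * x := by
  have hlog := Real.log_two_gt_d9
  rw [Real.logb, div_le_iff₀ (by linarith)]
  nlinarith [Real.log_le_sub_one_of_pos hx]

lemma mul_two_pow_mul_lt_two_pow {M J K : ℕ} {C : ℝ} (hJ : 1 ≤ J) (hC : 1 ≤ C)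
    (hK : 25 * C * (M + 2 * Real.logb 2 J + 3) ≤ 4 * K) : J * 2 ^ M * C < (2 : ℝ) ^ K := by
  have hJ' : (1 : ℝ) ≤ J := mod_cast hJ
  have hlogJ : 0 ≤ Real.logb 2 J := Real.logb_nonneg one_lt_two hJ'
  have hlogC := logb_two_le_two_mul (zero_lt_one.trans_le hC)
  rw [← Real.rpow_natCast 2 K, ← Real.logb_lt_iff_lt_rpow one_lt_two (by positivity),
    Real.logb_mul (by positivity) (by positivity), Real.logb_mul (by positivity) (by positivity),
    Real.logb_pow, Real.logb_self_eq_one one_lt_two, mul_one]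
  have : (0 : ℝ) ≤ M := M.cast_nonneg
  nlinarith

lemma natCast_mul_two_pow_mul_ofReal_pow_lt {M J N k : ℕ} {a C : ℝ} (hC : 0 < C)
    (ha : a ≤ (1 / 2) ^ N) (h : J * 2 ^ M * C < (2 : ℝ) ^ (N * k)) :
    (J : ENNReal) * (2 ^ M * ENNReal.ofReal a ^ k) < ENNReal.ofReal (1 / C) := by
  calc (J : ENNReal) * (2 ^ M * ENNReal.ofReal a ^ k)
      ≤ J * (2 ^ M * ENNReal.ofReal ((1 / 2) ^ N) ^ k) := by gcongr
    _ = ENNReal.ofReal (J * (2 ^ M * ((1 / 2) ^ N) ^ k)) := by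
        rw [ENNReal.ofReal_mul (by positivity), ENNReal.ofReal_mul (by positivity),
          ENNReal.ofReal_pow (n := M) (by positivity), ENNReal.ofReal_pow (n := k) (by positivity),
          ENNReal.ofReal_natCast, ENNReal.ofReal_ofNat]
    _ < ENNReal.ofReal (1 / C) := by
        refine (ENNReal.ofReal_lt_ofReal_iff (by positivity)).2 ?_
        rw [← pow_mul, one_div_pow, ← mul_assoc, mul_one_div, div_lt_div_iff₀ (by positivity) hC,
          one_mul]
        exact h

end Numerics

end OrthogonalSubspaceGame

theorem mainTheorem7
    (d n M k m J : ℕ) (C β γ : ℝ)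
    (hd : 8 ≤ d) (hn : 1 ≤ n) (hnd : n ≤ d) (hJ : 1 ≤ J) (hC : 1 ≤ C)
    (hβ : 0 < β) (hβ1 : β ≤ 1) (hγ : 0 < γ) (hγ1 : γ ≤ 1)
    (hγβ : 3 * Real.exp 1 * Real.sqrt ((k : ℝ) * d / n) ≤ γ / β)
    (hkn : (k : ℝ) ≤ (n : ℝ) / 4)
    (hk : 50 * C * (((M : ℝ) + 2 * Real.logb 2 J + 3) / n) * Real.log (Real.sqrt d / γ) ≤ (k : ℝ))
    {Ω : Type*} [MeasurableSpace Ω] (ρ : MeasureTheory.Measure Ω)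
    [MeasureTheory.IsProbabilityMeasure ρ]
    (S : OrthogonalSubspaceGame.Strategy Ω d n M k m J)
    (hwin : ENNReal.ofReal (1 / C) ≤ S.winProb ρ hnd β γ) :
    (n : ℝ) / 2 < (m : ℝ) := by
  by_contra! hmn
  have hm2 : 2 * m ≤ n := by rify; linarith
  have hk4 : 4 * k ≤ n := by rify; linarith
  have hC0 : 0 < C := zero_lt_one.trans_le hC
  have hn0 : (0 : ℝ) < n := mod_cast hn
  have hlogJ : 0 ≤ Real.logb 2 J := Real.logb_nonneg one_lt_two (mod_cast hJ)
  have hlog : 1 / 2 ≤ Real.log (√d / γ) :=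
    OrthogonalSubspaceGame.one_half_le_log_sqrt_div
      (Real.exp_one_lt_three.le.trans (by norm_cast; omega)) hγ hγ1
  have hsize : 25 * C * (M + 2 * Real.logb 2 J + 3) ≤ k * n := by
    linarith [OrthogonalSubspaceGame.half_mul_le_mul_of_mul_div_mul_le
      (by positivity) (by positivity) hn0 hlog hk]
  have hk1 : 1 ≤ k := by
    have h : (0 : ℝ) < k * n := lt_of_lt_of_le (by positivity) hsize
    exact_mod_cast pos_of_mul_pos_left h hn0.le
  obtain ⟨N, hN⟩ : ∃ N, N + k + m = n := ⟨n - k - m, by omega⟩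
  have hn4N : n ≤ 4 * N := by omega
  have hlt : J * 2 ^ M * C < (2 : ℝ) ^ (N * k) := by
    refine OrthogonalSubspaceGame.mul_two_pow_mul_lt_two_pow hJ hC (hsize.trans ?_)
    exact_mod_cast (by linarith [Nat.mul_le_mul_left k hn4N] : k * n ≤ 4 * (N * k))
  have hslab := OrthogonalSubspaceGame.slabBound_le_one_half_pow hβ hγ hk1 hn hn4N hγβ
  refine (hwin.trans (S.winProb_le ρ hβ hγ hn hnd hN.le)).not_gt ?_
  exact OrthogonalSubspaceGame.natCast_mul_two_pow_mul_ofReal_pow_lt hC0 hslab hlt
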